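/- For $n\ge 3$ let $BP_n$ be the burnt pancake graph: its vertices are the $n!\,2^n$ signed permutations of $\{1,\dots,n\}$, that is, the lists $a_1a_2\cdots a_n$ of nonzero integers such that $|a_1|,\dots,|a_n|$ is a permutation of $1,\dots,n$; two vertices $a_1\cdots a_n$ and $b_1\cdots b_n$ are adjacent if and only if there is an integer $k$ with $1\le k\le n$ such that $a_i=-b_{k+1-i}$ for $1\le i\le k$ and $a_i=b_i$ for $k+1\le i\le n$. A fractional perfect matching of a finite simple graph $G$ is a function $f\colon E(G)\to[0,1]$ such that, for every vertex $v$, the values of $f$ on the edges incident with $v$ sum to $1$. Let $fmp(G)$ be the minimum size of a set $F\subseteq E(G)$ such that $G-F$ has no fractional perfect matching, and let $fsmp(G)$ be the minimum size of a set $F\subseteq V(G)\cup E(G)$ such that $G-F$ has no fractional perfect matching, where $G-F$ arises from $G$ by deleting the vertices in $F$ (with all their incident edges) and the edges in $F$. Then, for every $n\ge 3$, $$fsmp(BP_n)=fmp(BP_n)=n.$$ -/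

import Mathlib

namespace SimpleGraph

variable {V : Type*}

/-- `f` is a fractional matching of the finite graph `G`: each edge gets a number in `[0, 1]`,
and the numbers on the edges incident with any vertex sum to at most `1`.
Only the values of `f` on edges of `G` matter. -/
def IsFractionalMatching [Finite V] (G : SimpleGraph V) (f : Sym2 V → ℝ) : Prop :=
  (∀ e ∈ G.edgeSet, f e ∈ Set.Icc (0 : ℝ) 1) ∧
    ∀ v : V, ∑ᶠ e ∈ G.incidenceSet v, f e ≤ 1

/-- A fractional perfect matching: all the vertex sums are equal to `1`. -/
def IsFractionalPerfectMatching [Finite V] (G : SimpleGraph V) (f : Sym2 V → ℝ) : Prop :=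
  G.IsFractionalMatching f ∧ ∀ v : V, ∑ᶠ e ∈ G.incidenceSet v, f e = 1

def HasFractionalPerfectMatching [Finite V] (G : SimpleGraph V) : Prop :=
  ∃ f : Sym2 V → ℝ, G.IsFractionalPerfectMatching f

/-- The graph `G - (S ∪ F)` obtained by deleting the vertices in `S` (with all edges incident
with them) and the edges in `F`; its vertex set is the complement of `S`. -/
def deleteFaults (G : SimpleGraph V) (S : Finset V) (F : Finset (Sym2 V)) :
    SimpleGraph ((S : Set V)ᶜ : Set V) :=
  (G.deleteEdges (F : Set (Sym2 V))).induce ((S : Set V)ᶜ)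

/-- A set of edges of `G` whose deletion leaves no fractional perfect matching. -/
def IsFMPSet [Finite V] (G : SimpleGraph V) (F : Finset (Sym2 V)) : Prop :=
  (F : Set (Sym2 V)) ⊆ G.edgeSet ∧
    ¬ (G.deleteEdges (F : Set (Sym2 V))).HasFractionalPerfectMatching

/-- A set of vertices (`S`) and edges (`F`) of `G` whose deletion leaves no fractional perfect
matching. -/
def IsFSMPSet [Finite V] (G : SimpleGraph V) (S : Finset V) (F : Finset (Sym2 V)) : Prop :=
  (F : Set (Sym2 V)) ⊆ G.edgeSet ∧ ¬ (G.deleteFaults S F).HasFractionalPerfectMatching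

/-- The fractional matching preclusion number: the minimum size of an FMP set. -/
noncomputable def fmp [Finite V] (G : SimpleGraph V) : ℕ :=
  sInf {k : ℕ | ∃ F : Finset (Sym2 V), G.IsFMPSet F ∧ F.card = k}

/-- The fractional strong matching preclusion number: the minimum size of an FSMP set. -/
noncomputable def fsmp [Finite V] (G : SimpleGraph V) : ℕ :=
  sInf {k : ℕ | ∃ (S : Finset V) (F : Finset (Sym2 V)),
    G.IsFSMPSet S F ∧ S.card + F.card = k}

end SimpleGraph

/-- Signed symbols: `(m, false)` is the symbol `m` and `(m, true)` is the barred symbol `-m`;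
the absolute value is the first component. -/
abbrev SignedSymbol (n : ℕ) : Type := Fin n × Bool

/-- Change of sign. -/
def SignedSymbol.bar {n : ℕ} (x : SignedSymbol n) : SignedSymbol n := (x.1, !x.2)

/-- Signed permutations: lists of `n` signed symbols whose absolute values form a permutation. -/
abbrev SignedPerm (n : ℕ) : Type :=
  {a : Fin n → SignedSymbol n // Function.Bijective fun i => (a i).1}

/-- The burnt pancake graph `BP_n`: two signed permutations are adjacent if, for some
`1 ≤ k ≤ n`, one arises from the other by reversing the prefix of length `k` and changing the
sign of each symbol in it. Positions are counted from `0`, so that for `i + j + 1 = k` the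
positions `i` and `j` are exchanged by the reversal. -/
def burntPancakeGraph (n : ℕ) : SimpleGraph (SignedPerm n) where
  Adj a b := ∃ k : ℕ, 1 ≤ k ∧ k ≤ n ∧
    (∀ i j : Fin n, (i : ℕ) + (j : ℕ) + 1 = k → a.1 i = SignedSymbol.bar (b.1 j)) ∧
    (∀ i : Fin n, k ≤ (i : ℕ) → a.1 i = b.1 i)
  symm := ⟨by
    rintro a b ⟨k, h1, hn, h, h'⟩
    refine ⟨k, h1, hn, fun i j hij => ?_, fun i hi => (h' i hi).symm⟩
    rw [h j i (by omega)]
    simp [SignedSymbol.bar]⟩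
  loopless := ⟨by
    rintro a ⟨k, h1, hn, h, -⟩
    have e := h ⟨0, by omega⟩ ⟨k - 1, by omega⟩ (by simp; omega)
    have e' : (⟨0, by omega⟩ : Fin n) = ⟨k - 1, by omega⟩ := a.2.1 (by simp [e, SignedSymbol.bar])
    rw [← e'] at e
    simpa [SignedSymbol.bar] using congrArg Prod.snd e⟩

/-!
Deleting the `n` edges at a vertex of `BP_n` isolates it, so both numbers are at most `n`. For the
lower bound, `BP_n` minus any `n - 1` vertices and edges is shown to have a fractional perfect
matching, by induction on `n`.

Induction step: the signed permutations with a given last symbol induce a copy of `BP_{n-1}`, and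
the reversal of the whole list matches each vertex to a private neighbour in another part. If no
part contains all the faults, each part can be dealt with separately. Otherwise one of the faults
is ignored, the remaining ones are tolerated by their part, and the weight that the ignored fault
carries in the resulting fractional matching is replaced by weight on edges to private neighbours,
whose loss the other parts tolerate.

Base case, `n = 3` with two faults: if there is no fractional perfect matching, Tutte's condition
provides a set `I` of vertices that is isolated by deleting fewer than `#I` vertices. Counting
edges, either `BP_3` has a nontrivial edge cut of size at most `3`, or deleting two edges makes it
bipartite. The first is impossible because there would be an atom of a minimum nontrivial cut, and
the translates of an atom under the automorphisms partition the vertices. The second is impossible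
because `(r₁ r₂ r₃)³ = 1` for the prefix reversals gives a closed walk of odd length `9` from each
of the `48` vertices, and two edges meet at most `36` of these walks.
-/

open Finset

section DegreeCone

variable {V W : Type*} [Fintype V] [Fintype W] {G H : SimpleGraph V} {d : V → ℝ}

/-- The cone of the vectors of vertex sums of the nonnegative edge weightings of `G`. Thus `G - S`
has a fractional perfect matching exactly if the indicator of the complement of `S` lies in it.
Weightings are functions on all of `Sym2 V` that vanish outside the edges. -/
def degreeCone (G : SimpleGraph V) : PointedCone ℝ (V → ℝ) where
  carrier := {d | ∃ w : Sym2 V → ℝ, 0 ≤ w ∧ (∀ e ∉ G.edgeSet, w e = 0) ∧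
    ∀ v, ∑ u, w s(v, u) = d v}
  zero_mem' := ⟨0, le_rfl, by simp, by simp⟩
  add_mem' := by
    rintro d d' ⟨w, hw, hG, hd⟩ ⟨w', hw', hG', hd'⟩
    exact ⟨w + w', add_nonneg hw hw', fun e he => by simp [hG e he, hG' e he],
      fun v => by simp [sum_add_distrib, hd, hd']⟩
  smul_mem' := by
    rintro ⟨c, hc⟩ d ⟨w, hw, hG, hd⟩
    exact ⟨c • w, smul_nonneg hc hw, fun e he => by simp [hG e he],
      fun v => by simp [← mul_sum, hd, Nonneg.mk_smul]⟩

theorem degreeCone_mono (h : G ≤ H) : degreeCone G ≤ degreeCone H := by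
  rintro d ⟨w, hw, hG, hd⟩
  exact ⟨w, hw, fun e he => hG e fun he' => he (SimpleGraph.edgeSet_mono h he'), hd⟩

theorem indicator_pair_mem_degreeCone {u v : V} (h : G.Adj u v) :
    Set.indicator {u, v} 1 ∈ degreeCone G := by
  classical
  refine ⟨Pi.single s(u, v) 1, Pi.single_nonneg.2 zero_le_one, fun e he => ?_, fun a => ?_⟩
  · exact Pi.single_eq_of_ne (ne_of_mem_of_not_mem (G.mem_edgeSet.2 h) he).symm _
  · have huv := h.ne
    rcases eq_or_ne a u with rfl | hu
    · simp [Pi.single_apply, huv]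
    rcases eq_or_ne a v with rfl | hv
    · simp [Pi.single_apply, huv.symm]
    · simp [hu, hv]

theorem indicator_union_mem_degreeCone {A B : Set V} (hAB : Disjoint A B)
    (hA : Set.indicator A 1 ∈ degreeCone G) (hB : Set.indicator B 1 ∈ degreeCone G) :
    Set.indicator (A ∪ B) 1 ∈ degreeCone G := by
  rw [Set.indicator_union_of_disjoint hAB]
  exact add_mem hA hB

theorem indicator_biUnion_mem_degreeCone {ι : Type*} {I : Finset ι} {A : ι → Set V}
    (hA : (I : Set ι).PairwiseDisjoint A) (h : ∀ i ∈ I, Set.indicator (A i) 1 ∈ degreeCone G) :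
    Set.indicator (⋃ i ∈ I, A i) 1 ∈ degreeCone G := by
  rw [Finset.indicator_biUnion I A hA, ← Finset.sum_fn]
  exact sum_mem h

theorem indicator_mem_degreeCone_of_injective {A : Finset V} {σ : A → A}
    (hσ : Function.Injective σ) (hG : ∀ v : A, G.Adj v (σ v)) :
    Set.indicator (A : Set V) 1 ∈ degreeCone G := by
  classical
  have hmem : ∑ v : A, (2⁻¹ : ℝ) • Set.indicator {(v : V), (σ v : V)} 1 ∈ degreeCone G :=
    sum_mem fun v _ => (degreeCone G).smul_mem (by norm_num) (indicator_pair_mem_degreeCone (hG v))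
  convert hmem using 1
  ext a
  have hpair (v : A) : Set.indicator {(v : V), (σ v : V)} (1 : V → ℝ) a =
      (if a = v then 1 else 0) + if a = σ v then 1 else 0 := by
    rw [Set.insert_eq, Set.indicator_union_of_disjoint (by simpa using (hG v).ne)]
    simp [Set.indicator_apply]
  have hself : ∑ v : A, (if a = v then (1 : ℝ) else 0) = Set.indicator (A : Set V) 1 a := by
    rw [sum_coe_sort A fun v => if a = v then (1 : ℝ) else 0]
    simp [Set.indicator_apply]
  have himage : ∑ v : A, (if a = σ v then (1 : ℝ) else 0) = Set.indicator (A : Set V) 1 a := by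
    rw [← hself]
    exact (Finite.injective_iff_bijective.1 hσ).sum_comp fun v : A => if a = v then (1 : ℝ) else 0
  simp only [Finset.sum_apply, Pi.smul_apply, smul_eq_mul, ← mul_sum, hpair, sum_add_distrib,
    hself, himage]
  ring

theorem exists_vertex_deficit_mem_degreeCone (hd : d ∈ degreeCone G) (v : V) :
    ∃ x : V → ℝ, 0 ≤ x ∧ x ≤ d ∧ ∑ u, x u = d v ∧
      d - x - d v • Set.indicator {v} 1 ∈ degreeCone G := by
  classical
  obtain ⟨w, hw, hG, hd⟩ := hd
  refine ⟨fun u => w s(v, u), fun u => hw _, fun u => ?_, hd v,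
    fun e => if v ∈ e then 0 else w e, fun e => ?_, fun e he => by simp [hG e he], fun a => ?_⟩
  · change w s(v, u) ≤ d u
    rw [← hd u, Sym2.eq_swap]
    exact single_le_sum (fun b _ => hw s(u, b)) (mem_univ v)
  · dsimp only
    split_ifs
    exacts [le_rfl, hw e]
  · rcases eq_or_ne a v with rfl | ha
    · simp [hG s(a, a) (by simp)]
    · have hsplit (b : V) : (if v ∈ s(a, b) then 0 else w s(a, b)) =
          w s(a, b) - if b = v then w s(a, b) else 0 := by
        rcases eq_or_ne b v with rfl | hb <;> simp [ha.symm, *, Ne.symm]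
      simp only [hsplit, sum_sub_distrib, hd]
      simp [ha, Sym2.eq_swap]

theorem exists_edge_deficit_mem_degreeCone (hd : d ∈ degreeCone G) (u v : V) :
    ∃ c : ℝ, 0 ≤ c ∧ c ≤ d u ∧
      d - c • Set.indicator {u, v} 1 ∈ degreeCone (G.deleteEdges {s(u, v)}) := by
  classical
  obtain ⟨w, hw, hG, hd⟩ := hd
  refine ⟨w s(u, v), hw _, ?_, Function.update w s(u, v) 0, ?_, fun e he => ?_, fun a => ?_⟩
  · rw [← hd u]
    exact single_le_sum (fun b _ => hw s(u, b)) (mem_univ v)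
  · exact le_update_iff.2 ⟨le_rfl, fun e _ => hw e⟩
  · rcases eq_or_ne e s(u, v) with rfl | hne
    · simp
    · rw [Function.update_of_ne hne]
      exact hG e fun heG => he (by simp [heG, hne])
  · have hsplit (b : V) : Function.update w s(u, v) 0 s(a, b) =
        w s(a, b) - if s(a, b) = s(u, v) then w s(u, v) else 0 := by
      rcases eq_or_ne s(a, b) s(u, v) with h | h <;> simp [h]
    simp only [hsplit, sum_sub_distrib, hd]
    rcases eq_or_ne u v with rfl | huv
    · simp [hG s(u, u) (by simp)]
    · rcases eq_or_ne a u with rfl | hu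
      · simp [huv]
      · rcases eq_or_ne a v with rfl | hv <;> simp [*]

theorem indicator_image_mem_degreeCone {K : SimpleGraph W} {A : Set W}
    (hA : Set.indicator A 1 ∈ degreeCone K) (f : K →g G) (hf : Function.Injective f) :
    Set.indicator (f '' A) 1 ∈ degreeCone G := by
  classical
  obtain ⟨w, hw, hK, hd⟩ := hA
  have hf₂ : Function.Injective (Sym2.map f) := Sym2.map.injective hf
  refine ⟨Function.extend (Sym2.map f) w 0, fun e => ?_, fun e he => ?_, fun v => ?_⟩
  · by_cases h : ∃ e', Sym2.map f e' = e
    · obtain ⟨e', rfl⟩ := h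
      simpa [hf₂.extend_apply] using hw e'
    · simp [Function.extend_apply' _ _ _ h]
  · by_cases h : ∃ e', Sym2.map f e' = e
    · obtain ⟨e', rfl⟩ := h
      rw [hf₂.extend_apply]
      exact hK e' fun h => he (f.map_mem_edgeSet h)
    · simp [Function.extend_apply' _ _ _ h]
  · have hout (a b : V) (hb : b ∉ Set.range f) : Function.extend (Sym2.map f) w 0 s(a, b) = 0 := by
      refine Function.extend_apply' _ _ _ ?_
      rintro ⟨e, he⟩
      obtain ⟨c, -, hc⟩ := Sym2.mem_map.1 (he ▸ Sym2.mem_mk_right a b)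
      exact hb ⟨c, hc⟩
    by_cases hv : v ∈ Set.range f
    · obtain ⟨a, rfl⟩ := hv
      rw [Set.indicator_image hf, Pi.one_comp, ← hd a]
      refine (Fintype.sum_of_injective f hf _ _ (hout (f a)) fun b => ?_).symm
      rw [← hf₂.extend_apply w 0, Sym2.map_mk]
    · rw [Set.indicator_of_notMem fun h => hv (Set.image_subset_range f A h)]
      exact sum_eq_zero fun u _ => by rw [Sym2.eq_swap, hout u v hv]

theorem one_mem_degreeCone_induce {A : Set V} [Fintype A]
    (h : Set.indicator A 1 ∈ degreeCone G) : 1 ∈ degreeCone (G.induce A) := by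
  obtain ⟨w, hw, hG, hd⟩ := h
  have hzero {v u : V} (hu : u ∉ A) : w s(v, u) = 0 := by
    have hsum : ∑ v, w s(u, v) = 0 := by rw [hd, Set.indicator_of_notMem hu]
    rw [Sym2.eq_swap]
    exact (sum_eq_zero_iff_of_nonneg fun v _ => hw s(u, v)).1 hsum v (mem_univ v)
  refine ⟨fun e => w (Sym2.map Subtype.val e), fun e => hw _, ?_, fun v => ?_⟩
  · refine Sym2.ind fun u v he => hG _ ?_
    simpa using he
  · trans ∑ u, w s(v, u)
    · exact Fintype.sum_of_injective _ Subtype.val_injective _ _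
        (fun u hu => hzero (by simpa using hu)) fun u => rfl
    · rw [hd, Set.indicator_of_mem v.2, Pi.one_apply, Pi.one_apply]

theorem hasFractionalPerfectMatching_of_one_mem_degreeCone (h : 1 ∈ degreeCone G) :
    G.HasFractionalPerfectMatching := by
  obtain ⟨w, hw, hG, hd⟩ := h
  have hsum (v : V) : ∑ᶠ e ∈ G.incidenceSet v, w e = 1 := by
    have hinc : ∑ᶠ u ∈ G.neighborSet v, w s(v, u) = ∑ᶠ e ∈ G.incidenceSet v, w e :=
      finsum_mem_eq_of_bijOn (fun u => s(v, u)) ⟨fun u hu => ⟨hu, Sym2.mem_mk_left v u⟩,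
        fun u _ u' _ => Sym2.congr_right.1, fun e ⟨he, hv⟩ => by
          obtain ⟨u, rfl⟩ := Sym2.mem_iff_exists.1 hv
          exact ⟨u, he, rfl⟩⟩ fun _ _ => rfl
    rw [← hinc, finsum_mem_eq_sum_of_inter_support_eq (t := univ), hd, Pi.one_apply]
    ext u
    simpa using fun hu => not_imp_comm.1 (hG s(v, u)) hu
  refine ⟨w, ⟨fun e _ => ⟨hw e, ?_⟩, fun v => (hsum v).le⟩, hsum⟩
  induction e with
  | h u v =>
    rw [← Pi.one_apply (M := fun _ : V => ℝ) u, ← hd u]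
    exact single_le_sum (fun v _ => hw s(u, v)) (mem_univ v)

end DegreeCone

theorem indicator_mem_degreeCone_of_card_isolated_le {V : Type*} [Fintype V] [DecidableEq V]
    {G : SimpleGraph V} {A : Finset V}
    (h : ∀ T ⊆ A, ∀ I ⊆ A \ T, (∀ v ∈ I, ∀ u ∈ A \ T, ¬G.Adj v u) → #I ≤ #T) :
    Set.indicator (A : Set V) 1 ∈ degreeCone G := by
  classical
  let nbr (v : A) : Finset A := {u | G.Adj v u}
  suffices hall : ∀ B : Finset A, #B ≤ #(B.biUnion nbr) by
    obtain ⟨σ, hσ, hnbr⟩ := (all_card_le_biUnion_card_iff_exists_injective nbr).1 hall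
    exact indicator_mem_degreeCone_of_injective hσ fun v => by simpa [nbr] using hnbr v
  intro B
  let N := B.biUnion nbr
  have hmemN {v u : A} (hv : v ∈ B) (hvu : G.Adj v u) : u ∈ N :=
    mem_biUnion.2 ⟨v, hv, by simpa [nbr] using hvu⟩
  -- The members of `B` without a neighbour in `B` are isolated by deleting `N \ B`.
  let T := (N \ B).map (.subtype (· ∈ A))
  have hisolated : ∀ v ∈ (B \ N).map (.subtype (· ∈ A)), ∀ u ∈ A \ T, ¬G.Adj v u := by
    intro v hv u hu hvu
    obtain ⟨v, hvBN, rfl⟩ := mem_map.1 hv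
    obtain ⟨hvB, hvN⟩ := mem_sdiff.1 hvBN
    obtain ⟨huA, huT⟩ := mem_sdiff.1 hu
    have huN : ⟨u, huA⟩ ∈ N := hmemN hvB hvu
    have huB : ⟨u, huA⟩ ∈ B := by simpa [T, huN, huA] using huT
    exact hvN (hmemN huB hvu.symm)
  rw [← card_sdiff_le_card_sdiff_iff, ← card_map (.subtype (· ∈ A)), ← card_map (.subtype (· ∈ A))]
  refine h T (fun v hv => property_of_mem_map_subtype _ hv) _ (fun v hv => ?_) hisolated
  obtain ⟨v, hvBN, rfl⟩ := mem_map.1 hv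
  exact mem_sdiff.2 ⟨v.2, by simp [T, (mem_sdiff.1 hvBN).1]⟩

section Preclusion

variable {V : Type*} {G : SimpleGraph V}

section Isolation

variable [Finite V]

theorem not_hasFractionalPerfectMatching_of_isolated {v : V}
    (h : ∀ u, ¬G.Adj v u) : ¬G.HasFractionalPerfectMatching := by
  rintro ⟨f, -, hf⟩
  have hinc : G.incidenceSet v = ∅ := by
    refine Set.eq_empty_of_forall_notMem fun e ⟨he, hv⟩ => ?_
    obtain ⟨u, rfl⟩ := Sym2.mem_iff_exists.1 hv
    exact h u he
  simpa [hinc] using hf v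

open Classical in
theorem isFMPSet_incidenceFinset (G : SimpleGraph V) (v : V) [Fintype (G.neighborSet v)] :
    G.IsFMPSet (G.incidenceFinset v) := by
  refine ⟨by simpa using G.incidenceSet_subset v,
    not_hasFractionalPerfectMatching_of_isolated (v := v) ?_⟩
  simp +contextual

open Classical in
theorem isFSMPSet_incidenceFinset (G : SimpleGraph V) (v : V) [Fintype (G.neighborSet v)] :
    G.IsFSMPSet ∅ (G.incidenceFinset v) := by
  refine ⟨by simpa using G.incidenceSet_subset v,
    not_hasFractionalPerfectMatching_of_isolated (v := ⟨v, by simp⟩) ?_⟩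
  simp +contextual [SimpleGraph.deleteFaults]

end Isolation

variable [Fintype V] {k : ℕ}

/-- After the deletion of any `k` vertices and edges, `G` still has a fractional perfect matching,
in the form that is convenient for induction: the remaining graph keeps the vertex set of `G`, and
the vertex sums are `0` at the deleted vertices. The deleted edges need not be edges of `G`. -/
def ToleratesFaults (G : SimpleGraph V) (k : ℕ) : Prop :=
  ∀ (S : Finset V) (F : Finset (Sym2 V)), #S + #F ≤ k →
    Set.indicator (S : Set V)ᶜ 1 ∈ degreeCone (G.deleteEdges (F : Set (Sym2 V)))

namespace ToleratesFaults

theorem not_isFSMPSet (h : ToleratesFaults G k) {S : Finset V} {F : Finset (Sym2 V)}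
    (hSF : #S + #F ≤ k) : ¬G.IsFSMPSet S F := by
  classical
  exact fun hF => hF.2 <| hasFractionalPerfectMatching_of_one_mem_degreeCone <|
    one_mem_degreeCone_induce (h S F hSF)

theorem not_isFMPSet (h : ToleratesFaults G k) {F : Finset (Sym2 V)} (hF : #F ≤ k) :
    ¬G.IsFMPSet F := by
  refine fun hF' => hF'.2 <| hasFractionalPerfectMatching_of_one_mem_degreeCone ?_
  simpa using h ∅ F (by simpa using hF)

theorem fmp_eq (h : ToleratesFaults G k) {v : V}
    [Fintype (G.neighborSet v)] (hv : G.degree v = k + 1) : G.fmp = k + 1 := by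
  classical
  have hmem : k + 1 ∈ {l | ∃ F, G.IsFMPSet F ∧ #F = l} :=
    ⟨_, isFMPSet_incidenceFinset G v, by rw [G.card_incidenceFinset_eq_degree, hv]⟩
  refine le_antisymm (Nat.sInf_le hmem) (le_csInf ⟨_, hmem⟩ ?_)
  rintro l ⟨F, hF, rfl⟩
  exact not_le.1 fun hle => h.not_isFMPSet hle hF

theorem fsmp_eq (h : ToleratesFaults G k) {v : V}
    [Fintype (G.neighborSet v)] (hv : G.degree v = k + 1) : G.fsmp = k + 1 := by
  classical
  have hmem : k + 1 ∈ {l | ∃ S F, G.IsFSMPSet S F ∧ #S + #F = l} :=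
    ⟨∅, _, isFSMPSet_incidenceFinset G v, by simp [hv]⟩
  refine le_antisymm (Nat.sInf_le hmem) (le_csInf ⟨_, hmem⟩ ?_)
  rintro l ⟨S, F, hF, rfl⟩
  exact not_le.1 fun hle => h.not_isFSMPSet hle hF

end ToleratesFaults

end Preclusion

namespace ToleratesFaults

variable {V W : Type*} [Fintype V] [Fintype W] {G : SimpleGraph V} {H : SimpleGraph W} {k : ℕ}

open Classical in
theorem indicator_range_sdiff_mem (h : ToleratesFaults H k) (f : H →g G)
    (hf : Function.Injective f) {S : Finset V} {F : Finset (Sym2 V)}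
    (hSF : #{v ∈ S | v ∈ Set.range f} + #{e ∈ F | ∀ v ∈ e, v ∈ Set.range f} ≤ k) :
    Set.indicator (Set.range f \ S) 1 ∈ degreeCone (G.deleteEdges (F : Set (Sym2 V))) := by
  let S' : Finset W := {a | f a ∈ S}
  let F' : Finset (Sym2 W) := {e | Sym2.map f e ∈ F}
  have hS : #S' ≤ #{v ∈ S | v ∈ Set.range f} :=
    card_le_card_of_injOn f (by simp +contextual [S', Set.MapsTo]) hf.injOn
  have hF : #F' ≤ #{e ∈ F | ∀ v ∈ e, v ∈ Set.range f} := by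
    refine card_le_card_of_injOn (Sym2.map f) (fun e he => ?_) (Sym2.map.injective hf).injOn
    simp only [F', coe_filter, mem_univ, true_and, Set.mem_ofPred_eq] at he ⊢
    refine ⟨he, fun v hv => ?_⟩
    obtain ⟨a, -, rfl⟩ := Sym2.mem_map.1 hv
    exact Set.mem_range_self a
  let f' : H.deleteEdges (F' : Set (Sym2 W)) →g G.deleteEdges (F : Set (Sym2 V)) :=
    ⟨f, fun {a b} hab => by
      rw [SimpleGraph.deleteEdges_adj] at hab ⊢
      exact ⟨f.map_adj hab.1, by simpa [F'] using hab.2⟩⟩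
  have himage := indicator_image_mem_degreeCone (h S' F' (by omega)) f' hf
  convert himage using 2
  ext v
  simp only [Set.mem_sdiff, Set.mem_range, Set.mem_image]
  constructor
  · rintro ⟨⟨a, rfl⟩, ha⟩
    exact ⟨a, by simpa [S'] using! ha, rfl⟩
  · rintro ⟨a, ha, rfl⟩
    exact ⟨⟨a, rfl⟩, fun haS => ha (mem_coe.2 (mem_filter.2 ⟨mem_univ a, haS⟩))⟩

theorem of_bijective (h : ToleratesFaults H k) (f : H →g G) (hf : Function.Bijective f) :
    ToleratesFaults G k := by
  classical
  intro S F hSF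
  have hmem := h.indicator_range_sdiff_mem f hf.1
    ((add_le_add (card_filter_le S _) (card_filter_le F _)).trans hSF)
  rwa [hf.2.range_eq, ← Set.compl_eq_univ_sdiff] at hmem

open Classical in
theorem indicator_sdiff_mem {A : Set V} [Fintype A] (h : ToleratesFaults (G.induce A) k)
    {S : Finset V} {F : Finset (Sym2 V)}
    (hSF : #{v ∈ S | v ∈ A} + #{e ∈ F | ∀ v ∈ e, v ∈ A} ≤ k) :
    Set.indicator (A \ S) 1 ∈ degreeCone (G.deleteEdges (F : Set (Sym2 V))) := by
  let f : G.induce A →g G := ⟨Subtype.val, id⟩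
  have hf : Set.range f = A := Subtype.range_coe
  rw [← hf]
  refine h.indicator_range_sdiff_mem f Subtype.val_injective ?_
  convert hSF

end ToleratesFaults

section Partition

variable {V C : Type*} [Fintype V] {G : SimpleGraph V} {p : V → C} {m : V → V} {N : ℕ} {c : C}
  {S T : Finset V} {F : Finset (Sym2 V)}

theorem indicator_mem_degreeCone_of_fibres (p : V → C) {A : Set V}
    (h : ∀ c, Set.indicator (p ⁻¹' {c} ∩ A) 1 ∈ degreeCone G) :
    Set.indicator A 1 ∈ degreeCone G := by
  classical
  have hA : A = ⋃ c ∈ univ.image p, p ⁻¹' {c} ∩ A := by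
    ext v
    simp
  rw [hA]
  refine indicator_biUnion_mem_degreeCone (fun c _ c' _ hc => ?_) fun c _ => h c
  exact ((Set.disjoint_singleton.2 hc).preimage p).mono Set.inter_subset_left Set.inter_subset_left

namespace ToleratesFaults

variable [∀ c, Fintype (p ⁻¹' {c})]

theorem indicator_compl_fibre_sdiff_mem (h : ∀ c, ToleratesFaults (G.induce (p ⁻¹' {c})) N)
    (hF : ∀ e ∈ F, ∀ v ∈ e, p v = c) (hT : #T ≤ N) :
    Set.indicator ((p ⁻¹' {c})ᶜ \ T) 1 ∈ degreeCone (G.deleteEdges (F : Set (Sym2 V))) := by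
  classical
  refine indicator_mem_degreeCone_of_fibres p fun c' => ?_
  rcases eq_or_ne c' c with rfl | hc
  · rw [← Set.inter_sdiff_assoc, Set.inter_compl_self, Set.empty_sdiff, Set.indicator_empty']
    exact zero_mem _
  · have hfibre : p ⁻¹' {c'} ∩ ((p ⁻¹' {c})ᶜ \ T) = p ⁻¹' {c'} \ T := by
      grind
    have hFc : #{e ∈ F | ∀ v ∈ e, v ∈ p ⁻¹' {c'}} = 0 := by
      refine card_eq_zero.2 (filter_eq_empty_iff.2 fun e he hec => hc ?_)
      rw [← hF e he _ e.out_fst_mem]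
      exact (hec _ e.out_fst_mem).symm
    rw [hfibre]
    exact (h c').indicator_sdiff_mem (by rw [hFc]; exact (card_filter_le _ _).trans hT)

/-- Each vertex of `T` is matched to its private neighbour, and the rest of the other parts
tolerates the loss of these neighbours. -/
theorem indicator_union_compl_fibre_mem (h : ∀ c, ToleratesFaults (G.induce (p ⁻¹' {c})) N)
    (hm : Function.Injective m) (hadj : ∀ v, G.Adj v (m v)) (hpm : ∀ v, p (m v) ≠ p v)
    (hF : ∀ e ∈ F, ∀ v ∈ e, p v = c) (hT : #T ≤ N) (hTc : ∀ v ∈ T, p v = c) :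
    Set.indicator (T ∪ (p ⁻¹' {c})ᶜ) 1 ∈ degreeCone (G.deleteEdges (F : Set (Sym2 V))) := by
  classical
  have hadjF (v : V) (hv : v ∈ T) : (G.deleteEdges (F : Set (Sym2 V))).Adj v (m v) := by
    refine SimpleGraph.deleteEdges_adj.2 ⟨hadj v, fun hvF => hpm v ?_⟩
    rw [hTc v hv, hF _ hvF _ (Sym2.mem_mk_right v (m v))]
  have hdisj : (T : Set V).PairwiseDisjoint fun v => ({v, m v} : Set V) := by
    intro u hu v hv huv
    have := hm.ne huv
    rw [Function.onFun, Set.disjoint_left]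
    grind
  have hmatched : Set.indicator (⋃ v ∈ T, {v, m v}) 1 ∈
      degreeCone (G.deleteEdges (F : Set (Sym2 V))) :=
    indicator_biUnion_mem_degreeCone hdisj fun v hv => indicator_pair_mem_degreeCone (hadjF v hv)
  have hrest := indicator_compl_fibre_sdiff_mem h hF (card_image_le.trans hT : #(T.image m) ≤ N)
  convert indicator_union_mem_degreeCone ?_ hmatched hrest using 2
  · ext v
    simp only [Set.mem_union, SetLike.mem_coe, Set.mem_compl_iff, Set.mem_preimage,
      Set.mem_singleton_iff, coe_image, Set.mem_iUnion, Set.mem_insert_iff, exists_prop,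
      Set.mem_sdiff, Set.mem_image]
    grind
  · rw [Set.disjoint_left]
    simp only [Set.mem_iUnion, Set.mem_insert_iff, Set.mem_singleton_iff, exists_prop, coe_image,
      Set.mem_sdiff, Set.mem_compl_iff, Set.mem_preimage, Set.mem_image, SetLike.mem_coe]
    grind

theorem indicator_compl_mem_of_vertex_mem (h : ∀ c, ToleratesFaults (G.induce (p ⁻¹' {c})) N)
    (hm : Function.Injective m) (hadj : ∀ v, G.Adj v (m v)) (hpm : ∀ v, p (m v) ≠ p v)
    (hN : 1 ≤ N) (hS : ∀ v ∈ S, p v = c) (hF : ∀ e ∈ F, ∀ v ∈ e, p v = c)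
    (hSF : #S + #F ≤ N + 1) {v : V} (hv : v ∈ S) :
    Set.indicator (S : Set V)ᶜ 1 ∈ degreeCone (G.deleteEdges (F : Set (Sym2 V))) := by
  classical
  have hbudget : #{u ∈ S.erase v | u ∈ p ⁻¹' {c}} + #{e ∈ F | ∀ u ∈ e, u ∈ p ⁻¹' {c}} ≤ N := by
    have := card_filter_le (S.erase v) (· ∈ p ⁻¹' {c})
    have := card_filter_le F fun e => ∀ u ∈ e, u ∈ p ⁻¹' {c}
    have := card_erase_lt_of_mem hv
    omega
  obtain ⟨x, hx₀, hx₁, hsum, hdeficit⟩ :=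
    exists_vertex_deficit_mem_degreeCone ((h c).indicator_sdiff_mem hbudget) v
  have hx_eq_zero (u : V) (hu : p u ≠ c) : x u = 0 :=
    le_antisymm (by simpa [hu] using hx₁ u) (hx₀ u)
  have hrepair (u : V) : x u • Set.indicator ({u} ∪ (p ⁻¹' {c})ᶜ) (1 : V → ℝ) ∈
      degreeCone (G.deleteEdges (F : Set (Sym2 V))) := by
    by_cases hu : p u = c
    · refine PointedCone.smul_mem _ (hx₀ u) ?_
      simpa using indicator_union_compl_fibre_mem (T := {u}) h hm hadj hpm hF (by simpa using hN)
        (by simpa using hu)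
    · rw [hx_eq_zero u hu, zero_smul]
      exact zero_mem _
  have hvc : p v = c := hS v hv
  replace hsum : ∑ u, x u = 1 := by simpa [hvc] using hsum
  have hrepaired : ∑ u, x u • Set.indicator ({u} ∪ (p ⁻¹' {c})ᶜ) (1 : V → ℝ) =
      x + Set.indicator (p ⁻¹' {c})ᶜ 1 := by
    ext a
    by_cases ha : p a = c
    · simp [Set.indicator_apply, ha]
    · simp [ha, hsum, hx_eq_zero a ha]
  have hrepairs := sum_mem (t := univ) fun u _ => hrepair u
  rw [hrepaired] at hrepairs
  convert add_mem hdeficit hrepairs using 1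
  ext a
  have := hS a
  by_cases ha : p a = c <;> by_cases haS : a ∈ S <;> by_cases hav : a = v <;> simp_all

theorem indicator_one_mem_of_edge_mem (h : ∀ c, ToleratesFaults (G.induce (p ⁻¹' {c})) N)
    (hm : Function.Injective m) (hadj : ∀ v, G.Adj v (m v)) (hpm : ∀ v, p (m v) ≠ p v)
    (hN : 2 ≤ N) (hF : ∀ e ∈ F, ∀ v ∈ e, p v = c) (hFN : #F ≤ N + 1) {e : Sym2 V} (he : e ∈ F) :
    1 ∈ degreeCone (G.deleteEdges (F : Set (Sym2 V))) := by
  classical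
  induction e with | h u v
  have hbudget : #{u ∈ (∅ : Finset V) | u ∈ p ⁻¹' {c}} +
      #{e ∈ F.erase s(u, v) | ∀ u ∈ e, u ∈ p ⁻¹' {c}} ≤ N := by
    have := card_filter_le (F.erase s(u, v)) fun e => ∀ u ∈ e, u ∈ p ⁻¹' {c}
    have := card_erase_lt_of_mem he
    simp only [filter_empty, card_empty]
    omega
  obtain ⟨x, hx₀, hx₁, hdeficit⟩ :=
    exists_edge_deficit_mem_degreeCone ((h c).indicator_sdiff_mem hbudget) u v
  replace hx₁ : x ≤ 1 := by simpa [hF _ he u (Sym2.mem_mk_left u v)] using hx₁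
  have huv : ∀ a ∈ ({u, v} : Finset V), p a = c := by simpa using hF _ he
  have hends := indicator_union_compl_fibre_mem h hm hadj hpm hF (card_le_two.trans hN) huv
  have hrest := indicator_compl_fibre_sdiff_mem (T := ∅) h hF (by simp)
  have hdeficit_mem := degreeCone_mono (H := G.deleteEdges (F : Set (Sym2 V))) (by
    rw [SimpleGraph.deleteEdges_deleteEdges]
    exact SimpleGraph.deleteEdges_anti (by simp [he])) hdeficit
  convert add_mem (add_mem hdeficit_mem (PointedCone.smul_mem _ hx₀ hends))
    (PointedCone.smul_mem _ (sub_nonneg.2 hx₁) hrest) using 1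
  ext a
  by_cases ha : p a = c
  · simp [ha, Set.indicator_apply]
  · have hau : a ≠ u ∧ a ≠ v := by
      have := huv a
      grind
    simp [ha, hau]

theorem of_partition (h : ∀ c, ToleratesFaults (G.induce (p ⁻¹' {c})) N)
    (hm : Function.Injective m) (hadj : ∀ v, G.Adj v (m v)) (hpm : ∀ v, p (m v) ≠ p v)
    (hN : 2 ≤ N) : ToleratesFaults G (N + 1) := by
  classical
  intro S F hSF
  by_cases hparts : ∀ c, #{v ∈ S | v ∈ p ⁻¹' {c}} + #{e ∈ F | ∀ v ∈ e, v ∈ p ⁻¹' {c}} ≤ N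
  · exact indicator_mem_degreeCone_of_fibres p fun c => (h c).indicator_sdiff_mem (hparts c)
  obtain ⟨c, hc⟩ := not_forall.1 hparts
  have hSle := card_filter_le S (· ∈ p ⁻¹' {c})
  have hFle := card_filter_le F fun e => ∀ v ∈ e, v ∈ p ⁻¹' {c}
  have hScard : #{v ∈ S | v ∈ p ⁻¹' {c}} = #S := by omega
  have hFcard : #{e ∈ F | ∀ v ∈ e, v ∈ p ⁻¹' {c}} = #F := by omega
  have hS : ∀ v ∈ S, p v = c := filter_card_eq hScard
  have hF : ∀ e ∈ F, ∀ v ∈ e, p v = c := filter_card_eq hFcard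
  rcases S.eq_empty_or_nonempty with rfl | ⟨v, hv⟩
  · obtain ⟨e, he⟩ : F.Nonempty := by
      rw [nonempty_iff_ne_empty]
      rintro rfl
      simp at hc
    simpa using indicator_one_mem_of_edge_mem h hm hadj hpm hN hF (by simpa using hSF) he
  · exact indicator_compl_mem_of_vertex_mem h hm hadj hpm (by omega) hS hF hSF hv

end ToleratesFaults

end Partition

section Interedges

variable {V : Type*} {G : SimpleGraph V} [DecidableRel G.Adj]

theorem card_interedges_comm (X Y : Finset V) : #(G.interedges X Y) = #(G.interedges Y X) :=
  haveI : Std.Symm G.Adj := ⟨fun _ _ => SimpleGraph.Adj.symm⟩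
  Rel.card_interedges_comm _ _

theorem card_interedges_self_add_card_le (X : Finset V) :
    #(G.interedges X X) + #X ≤ #X * #X := by
  classical
  have hsub : G.interedges X X ⊆ X.offDiag := fun e he => by
    rw [SimpleGraph.mem_interedges_iff] at he
    exact mem_offDiag.2 ⟨he.1, he.2.1, he.2.2.ne⟩
  have := (card_le_card hsub).trans_eq X.offDiag_card
  have := Nat.le_mul_self #X
  omega

variable [DecidableEq V]

theorem card_interedges_union_right (X : Finset V) {Y Z : Finset V} (h : Disjoint Y Z) :
    #(G.interedges X (Y ∪ Z)) = #(G.interedges X Y) + #(G.interedges X Z) := by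
  simp_rw [SimpleGraph.interedges_def]
  rw [product_union, filter_union, card_union_of_disjoint]
  exact disjoint_filter_filter (disjoint_product.2 (Or.inr h))

theorem card_interedges_union_left {X Y : Finset V} (h : Disjoint X Y) (Z : Finset V) :
    #(G.interedges (X ∪ Y) Z) = #(G.interedges X Z) + #(G.interedges Y Z) := by
  rw [card_interedges_comm, card_interedges_union_right Z h, card_interedges_comm Z,
    card_interedges_comm Z]

variable [Fintype V] {d : ℕ} {X Y : Finset V}

theorem card_interedges_eq_sum (X Y : Finset V) :
    #(G.interedges X Y) = ∑ v ∈ X, #(G.neighborFinset v ∩ Y) := by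
  simp_rw [SimpleGraph.interedges_def, card_filter, sum_product, ← card_filter]
  refine sum_congr rfl fun v _ => congrArg card ?_
  ext u
  simp [and_comm]

theorem card_interedges_add_card_interedges_compl_right (hG : G.IsRegularOfDegree d)
    (X Y : Finset V) : #(G.interedges X Y) + #(G.interedges X Yᶜ) = d * #X := by
  simp_rw [card_interedges_eq_sum, ← sum_add_distrib]
  rw [mul_comm, ← smul_eq_mul, ← sum_const]
  refine sum_congr rfl fun v _ => ?_
  rw [← sdiff_eq_inter_compl, card_inter_add_card_sdiff, SimpleGraph.card_neighborFinset_eq_degree,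
    hG v]

variable (G) in
/-- The number of edges between `X` and its complement, counted as darts leaving `X`. -/
def cutSize (X : Finset V) : ℕ := #(G.interedges X Xᶜ)

theorem cutSize_compl (X : Finset V) : cutSize G Xᶜ = cutSize G X := by
  rw [cutSize, cutSize, compl_compl, card_interedges_comm]

theorem cutSize_inter_add_cutSize_union_le (X Y : Finset V) :
    cutSize G (X ∩ Y) + cutSize G (X ∪ Y) ≤ cutSize G X + cutSize G Y := by
  have hcut (Z : Finset V) : cutSize G Z =
      ∑ e : V × V, if e.1 ∈ Z ∧ e.2 ∉ Z ∧ G.Adj e.1 e.2 then 1 else 0 := by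
    rw [cutSize, ← card_filter]
    congr 1
    ext e
    simp [SimpleGraph.mem_interedges_iff]
  simp_rw [hcut, ← sum_add_distrib]
  refine sum_le_sum fun e _ => ?_
  grind

theorem cutSize_sdiff_add_cutSize_sdiff_le (X Y : Finset V) :
    cutSize G (X \ Y) + cutSize G (Y \ X) ≤ cutSize G X + cutSize G Y := by
  have h := cutSize_inter_add_cutSize_union_le (G := G) X Yᶜ
  have hunion : X ∪ Yᶜ = (Y \ X)ᶜ := by
    ext v
    simp [imp_iff_or_not]
  rwa [← sdiff_eq_inter_compl, hunion, cutSize_compl, cutSize_compl] at h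

theorem cutSize_image (φ : G ≃g G) (X : Finset V) : cutSize G (X.image φ) = cutSize G X := by
  symm
  refine card_equiv (φ.toEquiv.prodCongr φ.toEquiv) fun e => ?_
  simp [SimpleGraph.mem_interedges_iff, φ.map_adj_iff]

theorem cutSize_pos (hG : G.Connected) (hX : X.Nonempty) (hXc : Xᶜ.Nonempty) :
    0 < cutSize G X := by
  obtain ⟨u, hu⟩ := hX
  obtain ⟨v, hv⟩ := hXc
  obtain ⟨p⟩ := hG.preconnected u v
  obtain ⟨e, -, he, he'⟩ := p.exists_boundary_dart X hu (by simpa using hv)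
  exact card_pos.2 ⟨e.toProd, (SimpleGraph.mem_interedges_iff _).2 ⟨he, mem_compl.2 he', e.adj⟩⟩

variable (G) in
/-- A nontrivial edge cut is one with at least two vertices on either side. An atom is a side of a
minimum nontrivial edge cut, with as few vertices as possible. -/
structure IsCutAtom (X : Finset V) : Prop where
  two_le_card : 2 ≤ #X
  two_le_card_compl : 2 ≤ #Xᶜ
  cutSize_le {Y : Finset V} : 2 ≤ #Y → 2 ≤ #Yᶜ → cutSize G X ≤ cutSize G Y
  card_le {Y : Finset V} : 2 ≤ #Y → 2 ≤ #Yᶜ → cutSize G Y = cutSize G X → #X ≤ #Y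

theorem exists_isCutAtom (hX : 2 ≤ #X) (hXc : 2 ≤ #Xᶜ) :
    ∃ Y, IsCutAtom G Y ∧ cutSize G Y ≤ cutSize G X := by
  obtain ⟨Y, hY, hmin⟩ := exists_min_image {Y : Finset V | 2 ≤ #Y ∧ 2 ≤ #Yᶜ}
    (fun Y => toLex (cutSize G Y, #Y)) ⟨X, by simp [hX, hXc]⟩
  simp only [mem_filter_univ, Prod.Lex.toLex_le_toLex] at hY hmin
  have hle (Z : Finset V) (hZ : 2 ≤ #Z) (hZc : 2 ≤ #Zᶜ) : cutSize G Y ≤ cutSize G Z :=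
    (hmin Z ⟨hZ, hZc⟩).elim le_of_lt fun h => h.1.le
  refine ⟨Y, ⟨hY.1, hY.2, hle _, fun hZ hZc h => ?_⟩, hle X hX hXc⟩
  exact ((hmin _ ⟨hZ, hZc⟩).resolve_left (by omega)).2

theorem IsCutAtom.two_mul_card_le (hX : IsCutAtom G X) : 2 * #X ≤ Fintype.card V := by
  have hcard := X.card_add_card_compl
  have hle : #X ≤ #Xᶜ := hX.card_le hX.two_le_card_compl
    (by simpa using hX.two_le_card) (cutSize_compl X)
  omega

theorem IsCutAtom.image (hX : IsCutAtom G X) (φ : G ≃g G) : IsCutAtom G (X.image φ) := by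
  have hcard : #(X.image φ) = #X := card_image_of_injective X φ.injective
  have hcardc : #(X.image φ)ᶜ = #Xᶜ := by rw [card_compl, card_compl, hcard]
  constructor
  · exact hcard ▸ hX.two_le_card
  · exact hcardc ▸ hX.two_le_card_compl
  · exact fun hY hYc => cutSize_image φ X ▸ hX.cutSize_le hY hYc
  · exact fun hY hYc h => hcard ▸ hX.card_le hY hYc (h.trans (cutSize_image φ X))

/-- Submodularity makes `X ∩ Y`, or else `X \ Y`, a side of a minimum nontrivial cut. -/
theorem IsCutAtom.eq_of_not_disjoint (hX : IsCutAtom G X) (hY : IsCutAtom G Y) (h3 : 3 ≤ #X)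
    (hXY : ¬Disjoint X Y) : X = Y := by
  have hcut : cutSize G X = cutSize G Y :=
    (hX.cutSize_le hY.two_le_card hY.two_le_card_compl).antisymm
      (hY.cutSize_le hX.two_le_card hX.two_le_card_compl)
  have hcard : #X = #Y := (hX.card_le hY.two_le_card hY.two_le_card_compl hcut.symm).antisymm
    (hY.card_le hX.two_le_card hX.two_le_card_compl hcut)
  have hinter : 0 < #(X ∩ Y) := card_pos.2 (not_disjoint_iff_nonempty_inter.1 hXY)
  have hXsdiff := card_sdiff_add_card_inter X Y
  have hYsdiff := card_sdiff_add_card_inter Y X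
  rw [inter_comm] at hYsdiff
  have hunion := card_union_add_card_inter X Y
  have htwo := hX.two_mul_card_le
  have hcompl (Z : Finset V) := Z.card_add_card_compl
  have := hX.two_le_card_compl
  obtain h1 | h2 : #(X ∩ Y) = 1 ∨ 2 ≤ #(X ∩ Y) := by omega
  · have hsub := cutSize_sdiff_add_cutSize_sdiff_le (G := G) X Y
    have hX' := hX.cutSize_le (Y := X \ Y) (by omega) (by grind)
    have hY' := hX.cutSize_le (Y := Y \ X) (by omega) (by grind)
    have := hX.card_le (Y := X \ Y) (by omega) (by grind) (by omega)
    omega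
  · have hsub := cutSize_inter_add_cutSize_union_le (G := G) X Y
    have hinter' := hX.cutSize_le (Y := X ∩ Y) h2 (by grind)
    have hunion' := hX.cutSize_le (Y := X ∪ Y) (by omega) (by grind)
    have := hX.card_le (Y := X ∩ Y) h2 (by grind) (by omega)
    rw [← eq_of_subset_of_card_le inter_subset_left this, inter_comm]
    exact eq_of_subset_of_card_le inter_subset_left (by rw [inter_comm]; omega)

theorem three_le_card_of_cutSize_le (hG : G.IsRegularOfDegree d) (hd : 3 ≤ d)
    (hX : 2 ≤ #X) (hcut : cutSize G X ≤ d) : 3 ≤ #X := by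
  by_contra! h
  have h2 : #X = 2 := by omega
  have hdeg := card_interedges_add_card_interedges_compl_right hG X X
  have hself := card_interedges_self_add_card_le (G := G) X
  rw [cutSize] at hcut
  rw [h2] at hdeg hself
  omega

/-- The translates of an atom `X` under automorphisms partition the vertices, so `G` induces a
regular graph on `X`. -/
theorem IsCutAtom.exists_card_neighborFinset_inter_eq (hX : IsCutAtom G X) (h3 : 3 ≤ #X)
    (htrans : ∀ u v, ∃ φ : G ≃g G, φ u = v) : ∃ k, ∀ v ∈ X, #(G.neighborFinset v ∩ X) = k := by
  obtain ⟨u, hu⟩ : X.Nonempty := card_pos.1 (by omega)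
  refine ⟨#(G.neighborFinset u ∩ X), fun v hv => ?_⟩
  obtain ⟨φ, rfl⟩ := htrans u v
  have himage : X = X.image φ := hX.eq_of_not_disjoint (hX.image φ) h3
    (not_disjoint_iff.2 ⟨φ u, hv, mem_image_of_mem φ hu⟩)
  symm
  refine card_equiv φ.toEquiv fun w => ?_
  conv_rhs => rw [himage]
  simp [φ.map_adj_iff]

theorem isClique_of_card_neighborFinset_inter_eq {k : ℕ}
    (hk : ∀ v ∈ X, #(G.neighborFinset v ∩ X) = k) (hX : #X = k + 1) : G.IsClique X := by
  intro u hu v hv huv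
  have hsub : G.neighborFinset u ∩ X ⊆ X.erase u := fun w hw => by
    simp only [mem_inter, SimpleGraph.mem_neighborFinset] at hw
    exact mem_erase.2 ⟨hw.1.ne', hw.2⟩
  have heq := eq_of_subset_of_card_le hsub (by rw [card_erase_of_mem hu, hk u hu, hX]; omega)
  have hmem : v ∈ G.neighborFinset u ∩ X := heq ▸ mem_erase.2 ⟨huv.symm, hv⟩
  exact (G.mem_neighborFinset u v).1 (mem_inter.1 hmem).1

theorem IsCutAtom.lt_cutSize (hX : IsCutAtom G X) (hconn : G.Connected)
    (hG : G.IsRegularOfDegree d) (hd : 3 ≤ d) (htrans : ∀ u v, ∃ φ : G ≃g G, φ u = v)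
    (hclique : G.CliqueFree d) : d < cutSize G X := by
  by_contra! hcut
  have h3 := three_le_card_of_cutSize_le hG hd hX.two_le_card hcut
  obtain ⟨k, hk⟩ := hX.exists_card_neighborFinset_inter_eq h3 htrans
  have hpos : 0 < cutSize G X := cutSize_pos hconn (card_pos.1 (by omega))
    (card_pos.1 (by have := hX.two_le_card_compl; omega))
  have hself : #(G.interedges X X) = k * #X := by
    rw [card_interedges_eq_sum, sum_congr rfl hk, sum_const, smul_eq_mul, mul_comm]
  have hdeg : k * #X + cutSize G X = d * #X :=
    hself ▸ card_interedges_add_card_interedges_compl_right hG X X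
  have hkX : k + 1 ≤ #X := by
    have := card_interedges_self_add_card_le (G := G) X
    rw [hself] at this
    nlinarith
  have hkd : k < d := Nat.lt_of_mul_lt_mul_right (a := #X) (by omega)
  obtain ⟨j, rfl⟩ := Nat.exists_eq_add_of_lt hkd
  have hjX : (j + 1) * #X ≤ k + j + 1 := by linarith
  obtain rfl | rfl : j = 0 ∨ k = 0 := by
    have := Nat.mul_le_mul_left (j + 1) hkX
    exact mul_eq_zero.1 (Nat.le_zero.1 (by linarith))
  · have hXk : #X = k + 1 := by omega
    exact hclique X ⟨isClique_of_card_neighborFinset_inter_eq hk hXk, hXk⟩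
  · nlinarith

theorem card_le_one_or_card_compl_le_one (hconn : G.Connected) (hG : G.IsRegularOfDegree d)
    (hd : 3 ≤ d) (htrans : ∀ u v, ∃ φ : G ≃g G, φ u = v) (hclique : G.CliqueFree d)
    (hX : cutSize G X ≤ d) : #X ≤ 1 ∨ #Xᶜ ≤ 1 := by
  by_contra! h
  obtain ⟨Y, hY, hYX⟩ := exists_isCutAtom (G := G) h.1 h.2
  have := hY.lt_cutSize hconn hG hd htrans hclique
  omega

end Interedges

section TwoFaults

variable {V : Type*}

theorem card_le_two_mul_of_sym2Mk_mem {D : Finset (V × V)} {F : Finset (Sym2 V)}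
    (h : ∀ e ∈ D, s(e.1, e.2) ∈ F) : #D ≤ 2 * #F := by
  classical
  refine card_le_mul_card_image_of_maps_to (f := fun e => s(e.1, e.2)) h 2 fun e he => ?_
  induction e with | _ u v =>
  refine (card_le_card (t := {(u, v), (v, u)}) fun e he => ?_).trans card_le_two
  simp only [mem_filter, Sym2.eq_iff] at he
  grind

variable [DecidableEq V] {G : SimpleGraph V} [DecidableRel G.Adj] {d : ℕ}

theorem card_interedges_self_add_two_mul_le {I R : Finset V} {F : Finset (Sym2 V)}
    (hIR : Disjoint I R) (hF : ∀ u ∈ I, ∀ v ∈ I ∪ R, G.Adj u v → s(u, v) ∈ F) :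
    #(G.interedges I I) + 2 * #(G.interedges I R) ≤ 2 * #F := by
  have hdisj : Disjoint (G.interedges I (I ∪ R)) (G.interedges R I) :=
    disjoint_left.2 fun e he he' =>
      disjoint_left.1 hIR ((SimpleGraph.mem_interedges_iff _).1 he).1
        ((SimpleGraph.mem_interedges_iff _).1 he').1
  have hcard := card_le_two_mul_of_sym2Mk_mem (D := G.interedges I (I ∪ R) ∪ G.interedges R I)
    (F := F) fun e he => by
      simp only [mem_union, SimpleGraph.mem_interedges_iff] at he
      rcases he with ⟨h1, h2, h⟩ | ⟨h1, h2, h⟩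
      · exact hF _ h1 _ (mem_union.2 h2) h
      · rw [Sym2.eq_swap]
        exact hF _ h2 _ (mem_union_right I h1) h.symm
  rw [card_union_of_disjoint hdisj, card_interedges_union_right I hIR,
    card_interedges_comm R I] at hcard
  omega

variable [Fintype V]

theorem card_add_le_card_of_forall_adj_mem (hG : G.IsRegularOfDegree d) (hd : 3 ≤ d)
    (hcut : ∀ X, cutSize G X ≤ d → #X ≤ 1 ∨ #Xᶜ ≤ 1)
    (hmono : ∀ X, 2 * d ≤ #(G.interedges X X) + #(G.interedges Xᶜ Xᶜ))
    {I T : Finset V} {F : Finset (Sym2 V)} (hI : I.Nonempty) (hIT : Disjoint I T)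
    (hF : ∀ u ∈ I, ∀ v ∉ T, G.Adj u v → s(u, v) ∈ F) {s : ℕ} (hs : s + #F ≤ 2) :
    #I + s ≤ #T := by
  by_contra! hcard
  have hmul : d * #T + d ≤ d * #I + d * s := by nlinarith
  obtain ⟨R, hR⟩ : ∃ R, R = (I ∪ T)ᶜ := ⟨_, rfl⟩
  have hIR : Disjoint I R := by
    rw [hR, compl_union]
    exact disjoint_compl_right.mono_right inter_subset_left
  have hT : Tᶜ = I ∪ R := by
    rw [hR, compl_union, union_inter_distrib_left, union_compl, univ_inter,
      union_eq_right.2 (subset_compl_iff_disjoint_right.2 hIT)]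
  have hFIR := card_interedges_self_add_two_mul_le hIR fun u hu v hv =>
    hF u hu v (by rwa [← mem_compl, hT])
  have hdegI := card_interedges_add_card_interedges_compl_right hG I T
  have hdegT := card_interedges_add_card_interedges_compl_right hG T T
  rw [hT, card_interedges_union_right _ hIR] at hdegI hdegT
  rw [card_interedges_comm T I] at hdegT
  have hcutIT : cutSize G (I ∪ T) = #(G.interedges I R) + #(G.interedges T R) := by
    rw [cutSize, ← hR, card_interedges_union_left hIT]
  have hs3 : s = 0 ∨ s = 1 ∨ s = 2 := by omega
  obtain hsmall | hsmall := hcut (I ∪ T) (by rcases hs3 with rfl | rfl | rfl <;> omega)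
  · rw [card_union_of_disjoint hIT] at hsmall
    have := hI.card_pos
    obtain ⟨hI1, rfl⟩ : #I = 1 ∧ T = ∅ := ⟨by omega, card_eq_zero.1 (by omega)⟩
    have hII := card_interedges_self_add_card_le (G := G) I
    have hI0 : #(G.interedges I ∅) = 0 := by simp [SimpleGraph.interedges_def]
    rw [hI1] at hdegI hII
    omega
  · rw [← hR] at hsmall
    have hRR := card_interedges_self_add_card_le (G := G) R
    have hR1 := Nat.mul_le_mul_right #R hsmall
    have := hmono (I ∪ R)
    rw [← hT, compl_compl, hT, card_interedges_union_left hIR, card_interedges_union_right _ hIR,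
      card_interedges_union_right _ hIR, card_interedges_comm R I] at this
    rcases hs3 with rfl | rfl | rfl <;> omega

theorem ToleratesFaults.two (hG : G.IsRegularOfDegree d) (hd : 3 ≤ d)
    (hcut : ∀ X, cutSize G X ≤ d → #X ≤ 1 ∨ #Xᶜ ≤ 1)
    (hmono : ∀ X, 2 * d ≤ #(G.interedges X X) + #(G.interedges Xᶜ Xᶜ)) : ToleratesFaults G 2 := by
  intro S F hSF
  rw [← coe_compl]
  refine indicator_mem_degreeCone_of_card_isolated_le fun T hT I hI hisolated => ?_
  obtain rfl | hne := I.eq_empty_or_nonempty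
  · rw [card_empty]
    exact Nat.zero_le _
  have hST : Disjoint T S := subset_compl_iff_disjoint_right.1 hT
  have hA : Sᶜ \ T = (T ∪ S)ᶜ := by rw [sdiff_eq_inter_compl, compl_union, inter_comm]
  rw [hA] at hI hisolated
  have hcard := card_add_le_card_of_forall_adj_mem hG hd hcut hmono hne
    (subset_compl_iff_disjoint_right.1 hI) (fun u hu v hv huv => by
      by_contra huvF
      exact hisolated u hu v (mem_compl.2 hv) (SimpleGraph.deleteEdges_adj.2 ⟨huv, huvF⟩)) hSF
  rw [card_union_of_disjoint hST] at hcard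
  omega

end TwoFaults

section OddWord

variable {V : Type*} [Fintype V] [DecidableEq V] {G : SimpleGraph V} [DecidableRel G.Adj]

theorem card_mem_iff_mem_le {σ : Equiv.Perm V} (hσ : ∀ v, G.Adj v (σ v)) (X : Finset V) :
    #{v | v ∈ X ↔ σ v ∈ X} ≤ #(G.interedges X X) + #(G.interedges Xᶜ Xᶜ) := by
  rw [← card_union_of_disjoint (disjoint_left.2 fun e he he' => by
    rw [SimpleGraph.mem_interedges_iff] at he he'
    exact mem_compl.1 he'.1 he.1)]
  refine card_le_card_of_injOn (fun v => (v, σ v)) (fun v hv => ?_)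
    fun u _ v _ h => congrArg Prod.fst h
  simp only [coe_filter, mem_univ, true_and, Set.mem_ofPred_eq] at hv
  simp only [coe_union, Set.mem_union, mem_coe, SimpleGraph.mk_mem_interedges_iff, mem_compl, hσ]
  tauto

theorem card_mem_iff_mem_iff_odd_le {l : List (Equiv.Perm V)} (hl : ∀ σ ∈ l, ∀ v, G.Adj v (σ v))
    (X : Finset V) : #{v | (v ∈ X ↔ l.prod v ∈ X) ↔ Odd l.length} ≤
      l.length * (#(G.interedges X X) + #(G.interedges Xᶜ Xᶜ)) := by
  induction l with
  | nil => simp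
  | cons σ l ih =>
    have hstep : #{v | l.prod v ∈ X ↔ σ (l.prod v) ∈ X} ≤
        #(G.interedges X X) + #(G.interedges Xᶜ Xᶜ) := by
      refine le_trans (card_equiv l.prod fun v => ?_).le
        (card_mem_iff_mem_le (hl σ List.mem_cons_self) X)
      simp only [mem_filter_univ]
    have hsub : ({v | (v ∈ X ↔ (σ :: l).prod v ∈ X) ↔ Odd (σ :: l).length} : Finset V) ⊆
        ({v | (v ∈ X ↔ l.prod v ∈ X) ↔ Odd l.length} : Finset V) ∪
          ({v | l.prod v ∈ X ↔ σ (l.prod v) ∈ X} : Finset V) := fun v => by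
      simp only [List.prod_cons, Equiv.Perm.mul_apply, List.length_cons, Nat.odd_add_one,
        mem_filter_univ, mem_union]
      tauto
    have hl' := ih fun τ hτ => hl τ (List.mem_cons_of_mem σ hτ)
    rw [List.length_cons, add_one_mul]
    exact (card_le_card hsub).trans ((card_union_le _ _).trans (add_le_add hl' hstep))

theorem card_le_length_mul_of_prod_eq_one {l : List (Equiv.Perm V)}
    (hl : ∀ σ ∈ l, ∀ v, G.Adj v (σ v)) (hprod : l.prod = 1) (hodd : Odd l.length) (X : Finset V) :
    Fintype.card V ≤ l.length * (#(G.interedges X X) + #(G.interedges Xᶜ Xᶜ)) := by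
  simpa [hprod, hodd] using card_mem_iff_mem_iff_odd_le hl X

end OddWord

namespace SignedPerm

variable {n : ℕ}

theorem fst_injective (a : SignedPerm n) : Function.Injective fun i => (a.1 i).1 := a.2.1

theorem bar_bar (x : SignedSymbol n) : x.bar.bar = x := by simp [SignedSymbol.bar]

theorem bar_ne (x : SignedSymbol n) : x.bar ≠ x := fun h => by
  simpa [SignedSymbol.bar] using congrArg Prod.snd h

/-- Reversal of the positions `0, …, k`. -/
def prefixRev (k i : Fin n) : Fin n := if i ≤ k then ⟨k - i, by omega⟩ else i

theorem prefixRev_le {k i : Fin n} (h : i ≤ k) : prefixRev k i ≤ k := by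
  rw [prefixRev, if_pos h]
  exact Fin.le_def.2 (Nat.sub_le _ _)

theorem prefixRev_involutive (k : Fin n) : Function.Involutive (prefixRev k) := by
  intro i
  by_cases h : i ≤ k
  · rw [prefixRev, if_pos (prefixRev_le h), Fin.ext_iff]
    simp only [prefixRev, h, if_true]
    exact Nat.sub_sub_self h
  · simp [prefixRev, h]

/-- The signed reversal of the prefix in the positions `0, …, k`: these are the moves along the
edges of the burnt pancake graph, the prefix length being `k + 1`. -/
def flip (k : Fin n) (a : SignedPerm n) : SignedPerm n :=
  ⟨fun i => if i ≤ k then (a.1 (prefixRev k i)).bar else a.1 i, by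
    convert a.2.comp (prefixRev_involutive k).bijective using 1
    ext i
    by_cases h : i ≤ k <;> simp [h, SignedSymbol.bar, prefixRev]⟩

theorem flip_apply (k : Fin n) (a : SignedPerm n) (i : Fin n) :
    (flip k a).1 i = if i ≤ k then (a.1 (prefixRev k i)).bar else a.1 i := rfl

theorem flip_apply_of_lt {k i : Fin n} (h : k < i) (a : SignedPerm n) :
    (flip k a).1 i = a.1 i := if_neg h.not_ge

theorem flip_apply_zero (k : Fin (n + 1)) (a : SignedPerm (n + 1)) :
    (flip k a).1 0 = (a.1 k).bar := by simp [flip_apply, prefixRev]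

theorem flip_apply_self (k : Fin (n + 1)) (a : SignedPerm (n + 1)) :
    (flip k a).1 k = (a.1 0).bar := by simp [flip_apply, prefixRev]

theorem flip_involutive (k : Fin n) : Function.Involutive (flip k) := by
  intro a
  refine Subtype.ext (funext fun i => ?_)
  have h2 := prefixRev_involutive k i
  by_cases h : i ≤ k
  · simp [flip_apply, h, prefixRev_le h, h2, bar_bar]
  · simp [flip_apply, h]

theorem flip_apply_self_ne (k : Fin n) (a : SignedPerm n) : (flip k a).1 k ≠ a.1 k := by
  cases n with
  | zero => exact k.elim0
  | succ n =>
    rw [flip_apply_self]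
    intro h
    have hfst := congrArg Prod.fst h
    obtain rfl := a.fst_injective hfst
    exact bar_ne _ h

theorem flip_left_injective (a : SignedPerm n) : Function.Injective fun k => flip k a := by
  intro k l h
  by_contra hkl
  have hlt : ∀ k l : Fin n, k < l → flip k a ≠ flip l a := fun k l hkl h =>
    flip_apply_self_ne l a (h ▸ flip_apply_of_lt hkl a)
  exact (lt_or_gt_of_ne hkl).elim (hlt k l · h) (hlt l k · h.symm)

theorem adj_flip (k : Fin n) (a : SignedPerm n) : (burntPancakeGraph n).Adj a (flip k a) := by
  refine ⟨k + 1, by omega, by omega, fun i j hij => ?_, fun i hi => ?_⟩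
  · have hj : j ≤ k := Fin.le_def.2 (by omega)
    have hrev : prefixRev k j = i := by
      simp only [prefixRev, hj, if_true, Fin.ext_iff]
      omega
    rw [flip_apply, if_pos hj, hrev, bar_bar]
  · exact (flip_apply_of_lt (Fin.lt_def.2 hi) a).symm

theorem adj_iff {a b : SignedPerm n} :
    (burntPancakeGraph n).Adj a b ↔ ∃ k, b = flip k a := by
  refine ⟨?_, fun ⟨k, hk⟩ => hk ▸ adj_flip k a⟩
  rintro ⟨k, h1, hn, h, h'⟩
  refine ⟨⟨k - 1, by omega⟩, Subtype.ext (funext fun i => ?_)⟩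
  by_cases hi : i.1 ≤ k - 1
  · rw [flip_apply, if_pos (Fin.le_def.2 hi), h _ i, bar_bar]
    simp only [prefixRev, Fin.le_def, hi, if_true]
    omega
  · rw [flip_apply_of_lt (Fin.lt_def.2 (not_le.1 hi)), h' i (by omega)]

theorem isRegularOfDegree [DecidableRel (burntPancakeGraph n).Adj] :
    (burntPancakeGraph n).IsRegularOfDegree n := by
  intro a
  have hnbr : (burntPancakeGraph n).neighborFinset a = univ.map ⟨_, flip_left_injective a⟩ := by
    ext b
    simp [adj_iff, eq_comm]
  rw [← SimpleGraph.card_neighborFinset_eq_degree, hnbr, card_map, card_univ, Fintype.card_fin]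

theorem cliqueFree_three : (burntPancakeGraph n).CliqueFree 3 := by
  intro s hs
  obtain ⟨a, b, c, hab, hac, hbc, -⟩ := SimpleGraph.is3Clique_iff.1 hs
  obtain ⟨i, rfl⟩ := adj_iff.1 hab
  obtain ⟨j, rfl⟩ := adj_iff.1 hac
  obtain ⟨k, hk⟩ := adj_iff.1 hbc
  have hij : i ≠ j := by
    rintro rfl
    exact hbc.ne rfl
  have hik : i ≠ k := by
    rintro rfl
    exact hac.ne (hk.trans (flip_involutive i a)).symm
  have hjk : j ≠ k := by
    rintro rfl
    exact hab.ne ((flip_involutive j).injective hk)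
  -- The symbol in the last position that is moved by any of the three flips is moved just once.
  obtain ⟨hi, hj⟩ | ⟨hj, hk'⟩ | ⟨hi, hk'⟩ :
      (i < k ∧ j < k) ∨ (j < i ∧ k < i) ∨ (i < j ∧ k < j) := by omega
  · refine flip_apply_self_ne k (flip i a) ?_
    rw [← hk, flip_apply_of_lt hi, flip_apply_of_lt hj]
  · refine flip_apply_self_ne i a ?_
    rw [← flip_apply_of_lt hk', ← hk, flip_apply_of_lt hj]
  · refine flip_apply_self_ne j a ?_
    rw [hk, flip_apply_of_lt hk', flip_apply_of_lt hi]

/-- The signed permutation `x`, with its symbols renamed by `v`. -/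
def relabel (v x : SignedPerm n) : SignedPerm n :=
  ⟨fun i => ((v.1 (x.1 i).1).1, xor (v.1 (x.1 i).1).2 (x.1 i).2), v.2.comp x.2⟩

theorem relabel_flip (v x : SignedPerm n) (k : Fin n) :
    relabel v (flip k x) = flip k (relabel v x) := by
  refine Subtype.ext (funext fun i => ?_)
  by_cases h : i ≤ k <;> simp [flip_apply, relabel, h, SignedSymbol.bar]

theorem relabel_injective (v : SignedPerm n) : Function.Injective (relabel v) := by
  intro x y h
  refine Subtype.ext (funext fun i => ?_)
  have hi : (relabel v x).1 i = (relabel v y).1 i := h ▸ rfl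
  have hvfst := congrArg Prod.fst hi
  have hfst : (x.1 i).1 = (y.1 i).1 := v.fst_injective hvfst
  have hsnd := congrArg Prod.snd hi
  simp only [relabel, hfst] at hsnd
  exact Prod.ext hfst (by simpa using hsnd)

/-- Renaming the symbols, as an automorphism of the burnt pancake graph. -/
noncomputable def relabelIso (v : SignedPerm n) : burntPancakeGraph n ≃g burntPancakeGraph n where
  toEquiv := .ofBijective (relabel v) (relabel_injective v).bijective_of_finite
  map_rel_iff' {x y} := by
    simp [adj_iff, ← relabel_flip, (relabel_injective v).eq_iff]

variable (n) in
/-- The identity permutation with positive signs; it is the unit of `relabel`. -/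
def identity : SignedPerm n := ⟨fun i => (i, false), Function.bijective_id⟩

theorem relabel_identity (v : SignedPerm n) : relabel v (identity n) = v :=
  Subtype.ext (funext fun i => by simp [relabel, identity])

theorem exists_iso_apply_eq (a b : SignedPerm n) :
    ∃ φ : burntPancakeGraph n ≃g burntPancakeGraph n, φ a = b := by
  have hid (v : SignedPerm n) : relabelIso v (identity n) = v := relabel_identity v
  refine ⟨(relabelIso a).symm.trans (relabelIso b), ?_⟩
  rw [RelIso.trans_apply, (relabelIso a).symm_apply_eq.2 (hid a).symm, hid b]

/-- The signed permutation with the last symbol `c` whose other symbols are those of `x`, renamed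
so as to avoid `c`. -/
def snoc (c : SignedSymbol (n + 1)) (x : SignedPerm n) : SignedPerm (n + 1) :=
  ⟨Fin.snoc (α := fun _ => SignedSymbol (n + 1))
      (fun i => (c.1.succAbove (x.1 i).1, (x.1 i).2)) c, by
    refine Function.Injective.bijective_of_finite fun i j h => ?_
    induction i using Fin.lastCases with
    | last =>
      induction j using Fin.lastCases with
      | last => rfl
      | cast j => exact absurd h (by simp [(Fin.succAbove_ne _ _).symm])
    | cast i =>
      induction j using Fin.lastCases with
      | last => exact absurd h (by simp [(Fin.succAbove_ne _ _)])
      | cast j => exact congrArg Fin.castSucc (x.fst_injective (by simpa using h))⟩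

theorem snoc_last (c : SignedSymbol (n + 1)) (x : SignedPerm n) :
    (snoc c x).1 (Fin.last n) = c := by simp [snoc]

theorem snoc_castSucc (c : SignedSymbol (n + 1)) (x : SignedPerm n) (i : Fin n) :
    (snoc c x).1 i.castSucc = (c.1.succAbove (x.1 i).1, (x.1 i).2) := by simp [snoc]

theorem snoc_injective (c : SignedSymbol (n + 1)) : Function.Injective (snoc c) := by
  intro x y h
  refine Subtype.ext (funext fun i => ?_)
  have hi : (snoc c x).1 i.castSucc = (snoc c y).1 i.castSucc := h ▸ rfl
  simp only [snoc_castSucc, Prod.mk.injEq, Fin.succAbove_right_inj] at hi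
  exact Prod.ext hi.1 hi.2

theorem exists_snoc_eq (a : SignedPerm (n + 1)) : ∃ x, snoc (a.1 (Fin.last n)) x = a := by
  have hne : ∀ i : Fin n, (a.1 i.castSucc).1 ≠ (a.1 (Fin.last n)).1 := fun i h =>
    (Fin.castSucc_lt_last i).ne (a.fst_injective h)
  choose f hf using fun i => Fin.exists_succAbove_eq (hne i)
  have hf_injective : Function.Injective f := fun i j h =>
    Fin.castSucc_injective n (a.fst_injective (by simp only [← hf, h]))
  refine ⟨⟨fun i => (f i, (a.1 i.castSucc).2), hf_injective.bijective_of_finite⟩,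
    Subtype.ext (funext fun i => ?_)⟩
  induction i using Fin.lastCases with
  | last => rw [snoc_last]
  | cast i => rw [snoc_castSucc]; exact Prod.ext (hf i) rfl

theorem snoc_flip (c : SignedSymbol (n + 1)) (x : SignedPerm n) (k : Fin n) :
    snoc c (flip k x) = flip k.castSucc (snoc c x) := by
  refine Subtype.ext (funext fun i => ?_)
  induction i using Fin.lastCases with
  | last => rw [flip_apply_of_lt (Fin.castSucc_lt_last k), snoc_last, snoc_last]
  | cast i =>
    rw [snoc_castSucc, flip_apply, flip_apply]
    by_cases h : i ≤ k
    · have hrev : prefixRev k.castSucc i.castSucc = (prefixRev k i).castSucc := by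
        simp [prefixRev, h]
      simp [h, hrev, snoc_castSucc, SignedSymbol.bar]
    · simp [h, snoc_castSucc]

theorem snoc_adj (c : SignedSymbol (n + 1)) {x y : SignedPerm n}
    (h : (burntPancakeGraph n).Adj x y) :
    (burntPancakeGraph (n + 1)).Adj (snoc c x) (snoc c y) := by
  obtain ⟨k, rfl⟩ := adj_iff.1 h
  rw [snoc_flip]
  exact adj_flip _ _

/-- The homomorphism `snoc c` onto the part of the burnt pancake graph with last symbol `c`. -/
def snocHom (c : SignedSymbol (n + 1)) : burntPancakeGraph n →g
    (burntPancakeGraph (n + 1)).induce ((fun a => a.1 (Fin.last n)) ⁻¹' {c}) where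
  toFun x := ⟨snoc c x, snoc_last c x⟩
  map_rel' := snoc_adj c

theorem snocHom_bijective (c : SignedSymbol (n + 1)) : Function.Bijective (snocHom c) := by
  refine ⟨fun x y h => snoc_injective c (congrArg Subtype.val h), fun ⟨a, ha⟩ => ?_⟩
  obtain ⟨x, hx⟩ := exists_snoc_eq a
  exact ⟨x, Subtype.ext ((congrArg (snoc · x) ha.symm).trans hx)⟩

theorem exists_reachable_last_eq (a : SignedPerm (n + 1)) (c : SignedSymbol (n + 1)) :
    ∃ b, (burntPancakeGraph (n + 1)).Reachable a b ∧ b.1 (Fin.last n) = c := by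
  obtain ⟨k, hk⟩ := a.2.surjective c.1
  have hflip (k : Fin (n + 1)) (a : SignedPerm (n + 1)) := (adj_flip k a).reachable
  obtain h | h : a.1 k = c ∨ a.1 k = c.bar := by
    rcases h : a.1 k with ⟨m, _ | _⟩ <;> rcases c with ⟨c, _ | _⟩ <;> simp_all [SignedSymbol.bar]
  · exact ⟨flip (Fin.last n) (flip k a), (hflip k a).trans (hflip _ _), by
      rw [flip_apply_self, flip_apply_zero, bar_bar, h]⟩
  · exact ⟨flip (Fin.last n) (flip 0 (flip k a)),
      ((hflip k a).trans (hflip _ _)).trans (hflip _ _), by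
      rw [flip_apply_self, flip_apply_self, flip_apply_zero, bar_bar, h, bar_bar]⟩

theorem preconnected : ∀ n, (burntPancakeGraph n).Preconnected
  | 0 => fun a b => Subsingleton.elim a b ▸ .rfl
  | n + 1 => fun a b => by
    obtain ⟨a', ha, hlast⟩ := exists_reachable_last_eq a (b.1 (Fin.last n))
    obtain ⟨x, hx⟩ := exists_snoc_eq a'
    obtain ⟨y, hy⟩ := exists_snoc_eq b
    rw [hlast] at hx
    have hxy := (preconnected n x y).map ⟨snoc _, snoc_adj (b.1 (Fin.last n))⟩
    exact ha.trans (by simpa [hx, hy] using hxy)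

theorem connected : (burntPancakeGraph n).Connected :=
  haveI : Nonempty (SignedPerm n) := ⟨identity n⟩
  ⟨preconnected n⟩

theorem card_signedPerm_three : Fintype.card (SignedPerm 3) = 48 := by decide +kernel

theorem prod_flip_eq_one :
    ([0, 1, 2, 0, 1, 2, 0, 1, 2].map fun k : Fin 3 => (flip_involutive k).toPerm).prod = 1 := by
  ext1 a
  refine Subtype.ext (funext fun i => ?_)
  fin_cases i <;> simp [flip_apply, prefixRev, bar_bar]

end SignedPerm

open SignedPerm

theorem toleratesFaults_burntPancakeGraph_three : ToleratesFaults (burntPancakeGraph 3) 2 := by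
  classical
  refine .two isRegularOfDegree le_rfl (fun X => card_le_one_or_card_compl_le_one connected
    isRegularOfDegree le_rfl exists_iso_apply_eq cliqueFree_three) fun X => ?_
  have hmono := card_le_length_mul_of_prod_eq_one (G := burntPancakeGraph 3) (fun σ hσ => by
    obtain ⟨k, -, rfl⟩ := List.mem_map.1 hσ
    exact adj_flip k) prod_flip_eq_one (by decide) X
  rw [card_signedPerm_three, List.length_map] at hmono
  simp only [List.length_cons, List.length_nil] at hmono
  omega

theorem toleratesFaults_burntPancakeGraph {n : ℕ} (hn : 3 ≤ n) :
    ToleratesFaults (burntPancakeGraph n) (n - 1) := by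
  induction n, hn using Nat.le_induction with
  | base => exact toleratesFaults_burntPancakeGraph_three
  | succ n hn ih =>
    classical
    have h := ToleratesFaults.of_partition (N := n - 1) (m := flip (Fin.last n))
      (fun c => ih.of_bijective (snocHom c) (snocHom_bijective c)) (flip_involutive _).injective
      (adj_flip _) (flip_apply_self_ne _) (by omega)
    rwa [Nat.sub_add_cancel (by omega)] at h

theorem theorem4p41 (n : ℕ) (hn : 3 ≤ n) :
    (burntPancakeGraph n).fsmp = n ∧ (burntPancakeGraph n).fmp = n := by
  classical
  have htol := toleratesFaults_burntPancakeGraph hn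
  have hn1 : n - 1 + 1 = n := Nat.sub_add_cancel (by omega)
  have hdeg : (burntPancakeGraph n).degree (identity n) = n - 1 + 1 := by
    rw [hn1, isRegularOfDegree]
  exact ⟨(htol.fsmp_eq hdeg).trans hn1, (htol.fmp_eq hdeg).trans hn1⟩
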